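/- Let $p$ be a prime number, $K$ a totally real number field, $L/K$ a Galois extension of $p$-power degree with $L$ totally real, and $\Sigma=\mathrm{Gal}(L/K)$. Let $S$ be a finite set of finite primes of $K$ containing all primes above $p$ and all primes that ramify in $L$. For an intermediate field $K\subseteq F\subseteq L$ put $\Sigma_F=\mathrm{Gal}(L/F)$. Let $L_S$ be the maximal abelian extension of $L$ that is unramified at all finite primes not above $S$, and $H_S=\mathrm{Gal}(L_S/L)$. The group $\Sigma$ acts on $H_S$ by $h\mapsto s h s^{-1}$, where $s\in\mathrm{Gal}(L_S/K)$ is any extension of $\sigma\in\Sigma$; let $\mathrm{Stab}_\Sigma(\varepsilon)$ be the stabilizer in $\Sigma$ of a function $\varepsilon$ on $H_S$ for the induced action. For an integral ideal $\mathfrak b$ of $L$ prime to $S$ write $\varepsilon(\mathfrak b)$ for the value of $\varepsilon$ at the Artin symbol $(\mathfrak b,L_S/L)\in H_S$. A locally constant function $\varepsilon$ on $H_S$ is called even if $\varepsilon(ch)=\varepsilon(h)$ for all $h\in H_S$ and all $c\in H_S$ that are restrictions of complex conjugation with respect to an embedding $L_S\hookrightarrow\mathbb C$. The M\"obius function $\mu_G$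 of the subgroups of a finite group $G$ is given by $\mu_G(1)=1$ and $\mu_G(G')=-\sum_{1\le G''<G'}\mu_G(G'')$ for $1\ne G'\le G$. Let $\mathbb Z_{(p)}\subset\mathbb Q$ be the localization of $\mathbb Z$ at $p\mathbb Z$. Fix a totally positive $\alpha\in\mathfrak o_K$. For $K\subseteq F\subseteq L$ let $[\alpha]_F$ be the set of pairs $(\alpha_F,\mathfrak a_F)$ with $0\ll\alpha_F\in\mathfrak a_F\subseteq\mathfrak o_F$, $\mathfrak a_F$ an ideal prime to $S$, and $\mathrm{Tr}_{F/K}(\alpha_F)=[F:K]\alpha$. Then: (1) For every $F$ the set $[\alpha]_F$ is finite, and $(\alpha_F,\mathfrak a_F)\mapsto(\alpha_F,\mathfrak a_F\mathfrak o_L)$ is a bijection from $[\alpha]_F$ onto the set of elements of $[\alpha]_L$ that are fixed by $\Sigma_F$ under $(\beta,\mathfrak b)\mapsto(\sigma\beta,\sigma\mathfrak b)$. (2) For every even positive integer $k$ and every even locally constant function $\varepsilon:H_S\to\mathbb Z_{(p)}$, $$\sum_{K\subseteq F\subseteq L}\mu_\Sigma(\Sigma_F)\sum_{(\alpha_F,\mathfrak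 a_F)\in[\alpha]_F}\varepsilon(\mathfrak a_F\mathfrak o_L)\,N_F(\mathfrak a_F)^{[L:F]k-1}\equiv 0 \mod |\mathrm{Stab}_\Sigma(\varepsilon)|\,\mathbb Z_{(p)},$$ where $N_F$ denotes the absolute norm. (3) For every finite $p$-group $P$ and every unit $r$ of $\mathbb Z_{(p)}$, $$\sum_{1\le P'\le P}\mu_P(P')\,r^{[P:P']}\equiv 0 \mod |P|\,\mathbb Z_{(p)}.$$ -/

import Mathlib

open NumberField IsDedekindDomain
open scoped Pointwise

noncomputable section

/-- The Möbius function `μ_G(H) = μ(1, H)` of the poset of subgroups of a finite group `G`. -/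
def subgroupMobius (G : Type*) [Group G] [Finite G] (H : Subgroup G) : ℤ := by
  classical
  letI : Fintype (Subgroup G) := Fintype.ofFinite _
  letI : LocallyFiniteOrder (Subgroup G) := Fintype.toLocallyFiniteOrder
  exact IncidenceAlgebra.mu ℤ ⊥ H

/-- The localization `ℤ_(p)` of `ℤ` at the prime ideal generated by `p`. -/
abbrev ZLoc (p : ℕ) [Fact p.Prime] : Type :=
  Localization.AtPrime (Ideal.span {(p : ℤ)})

/-- For `K ⊆ F ⊆ E` and a set `S` of finite primes of `K`: the extension `E / F` is unramified at
all finite primes of `E` that do not lie above a prime in `S`. -/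
def IsUnramifiedOutside (K F E : Type*) [Field K] [Field F] [Field E]
    [Algebra K E] [Algebra F E] (S : Finset (HeightOneSpectrum (𝓞 K))) : Prop :=
  ∀ Q : HeightOneSpectrum (𝓞 E), (∀ v ∈ S, ¬ Q.asIdeal.LiesOver v.asIdeal) →
    Algebra.IsUnramifiedAt (𝓞 F) Q.asIdeal

/-- The finite abelian extensions of `L`, inside an algebraic closure of `L`, that are unramified
outside the finite primes above `S` (no condition at the archimedean primes). -/
def finiteAbelianUnramified (K L : Type*) [Field K] [Field L] [Algebra K L]
    (S : Finset (HeightOneSpectrum (𝓞 K))) : Set (IntermediateField L (AlgebraicClosure L)) :=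
  {E | FiniteDimensional L E ∧ IsAbelianGalois L E ∧ IsUnramifiedOutside K L E S}

/-- `L_S`: the maximal abelian extension of `L` unramified outside the finite primes above `S`. -/
def maxAbelian (K L : Type*) [Field K] [Field L] [Algebra K L]
    (S : Finset (HeightOneSpectrum (𝓞 K))) : IntermediateField L (AlgebraicClosure L) :=
  sSup (finiteAbelianUnramified K L S)

/-- The group `H_S = Gal(L_S / L)`; as a Galois group it carries the Krull topology. -/
abbrev HS (K L : Type*) [Field K] [Field L] [Algebra K L]
    (S : Finset (HeightOneSpectrum (𝓞 K))) : Type _ :=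
  Gal(maxAbelian K L S / L)

theorem HS_mul_comm (K L : Type*) [Field K] [Field L] [Algebra K L]
    (S : Finset (HeightOneSpectrum (𝓞 K))) (σ τ : HS K L S) : σ * τ = τ * σ := by
  let M := maxAbelian K L S
  let c : HS K L S := σ * τ * σ⁻¹ * τ⁻¹
  let T : IntermediateField L M := IntermediateField.fixedField (Subgroup.zpowers c)
  have key : M ≤ IntermediateField.lift T := by
    refine sSup_le ?_
    intro E hE
    have hEM : E ≤ M := le_sSup hE
    obtain ⟨_, hab, _⟩ := hE
    let E' : IntermediateField L M := IntermediateField.restrict hEM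
    have : IsAbelianGalois L E' :=
      .of_algHom (IntermediateField.restrictAlgEquiv hEM).symm.toAlgHom
    intro y hy
    rw [IntermediateField.mem_lift ⟨y, hEM hy⟩]
    have h1 : AlgEquiv.restrictNormalHom E' c = 1 := by
      rw [show c = σ * τ * σ⁻¹ * τ⁻¹ from rfl, map_mul, map_mul, map_mul, map_inv, map_inv,
        this.is_comm.comm (AlgEquiv.restrictNormalHom E' σ), mul_inv_cancel_right, mul_inv_cancel]
    have hy' : (⟨y, hEM hy⟩ : M) ∈ E' := (IntermediateField.mem_restrict hEM _).2 hy
    have h2 : c (⟨y, hEM hy⟩ : M) = ⟨y, hEM hy⟩ := by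
      have := AlgEquiv.restrictNormal_commutes c E' ⟨_, hy'⟩
      rw [show AlgEquiv.restrictNormal c E' = 1 from h1] at this
      exact this.symm
    rintro ⟨g, hg⟩
    have hle : Subgroup.zpowers c ≤
        MulAction.stabilizer (HS K L S) (⟨y, hEM hy⟩ : M) := by
      rw [Subgroup.zpowers_le]
      exact h2
    exact hle hg
  have h : c = 1 := by
    ext x : 1
    have hx : x ∈ T := (IntermediateField.mem_lift x).1 (key x.2)
    exact hx ⟨_, Subgroup.mem_zpowers _⟩
  exact mul_inv_eq_iff_eq_mul.1 (mul_inv_eq_one.1 h)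

instance HS.instCommGroup (K L : Type*) [Field K] [Field L] [Algebra K L]
    (S : Finset (HeightOneSpectrum (𝓞 K))) : CommGroup (HS K L S) where
  mul_comm := HS_mul_comm K L S

/-- `h ∈ H_S` is a Frobenius automorphism at the prime `q` of `L`: one has `h x ≡ x ^ N(q) mod Q`
for all integers `x` of `L_S` and all primes `Q` of `L_S` above `q`. -/
def IsFrobeniusAt (K L : Type*) [Field K] [Field L] [Algebra K L]
    (S : Finset (HeightOneSpectrum (𝓞 K))) (q : Ideal (𝓞 L)) (h : HS K L S) : Prop :=
  ∀ Q : Ideal (𝓞 (maxAbelian K L S)), Q.IsPrime → Q.LiesOver q →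
    AlgHom.IsArithFrobAt (RingOfIntegers.mapAlgHom (k := L) h) Q

open Classical in
/-- The Frobenius automorphism in `H_S` at a prime `q` of `L` that is not above `S`, where it
exists and is unique. -/
def frobeniusAt (K L : Type*) [Field K] [Field L] [Algebra K L]
    (S : Finset (HeightOneSpectrum (𝓞 K))) (q : Ideal (𝓞 L)) : HS K L S :=
  if h : ∃ g, IsFrobeniusAt K L S q g then h.choose else 1

/-- The Artin symbol `(b, L_S / L) ∈ H_S` of an integral ideal `b` of `L` prime to `S`: the product
of the Frobenius automorphisms at the prime factors of `b`, counted with multiplicity. -/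
def artinSymbol (K L : Type*) [Field K] [Field L] [NumberField L] [Algebra K L]
    (S : Finset (HeightOneSpectrum (𝓞 K))) (b : Ideal (𝓞 L)) : HS K L S :=
  ((UniqueFactorizationMonoid.normalizedFactors b).map (frobeniusAt K L S)).prod

/-- A function `ε` on `H_S` is even if `ε (c h) = ε h` for all `h ∈ H_S` and all `c ∈ H_S` that are
the restriction of complex conjugation under some embedding of `L_S` into `ℂ`. -/
def IsEvenFunction {K L A : Type*} [Field K] [Field L] [Algebra K L]
    {S : Finset (HeightOneSpectrum (𝓞 K))} (ε : HS K L S → A) : Prop :=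
  ∀ (φ : maxAbelian K L S →+* ℂ) (c : HS K L S), ComplexEmbedding.IsConj φ c →
    ∀ h, ε (c * h) = ε h

/-- The element `s h s⁻¹` of `Gal(M / L)` for `s ∈ Gal(M / K)` and `h ∈ Gal(M / L)`, where
`L / K` is normal. -/
def conjGal {K L M : Type*} [Field K] [Field L] [Field M] [Algebra K L] [Algebra K M]
    [Algebra L M] [IsScalarTower K L M] [Normal K L] (s : Gal(M/K)) (h : Gal(M/L)) : Gal(M/L) :=
  { (s * h.restrictScalars K * s⁻¹).toRingEquiv with
    commutes' := fun x => by
      have h1 : s⁻¹ (algebraMap L M x) = algebraMap L M (s⁻¹.restrictNormal L x) :=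
        (AlgEquiv.restrictNormal_commutes s⁻¹ L x).symm
      change s (h (s⁻¹ (algebraMap L M x))) = algebraMap L M x
      rw [h1, AlgEquiv.commutes, ← h1]
      exact s.apply_symm_apply _ }

/-- The stabilizer in `Gal(L / K)` of a function `ε` on `H_S = Gal(L_S / L)`. An element `σ` of
`Gal(L / K)` acts on `H_S` by `h ↦ s h s⁻¹` for any extension `s ∈ Gal(L_S / K)` of `σ`. -/
def stabilizerFun {K L A : Type*} [Field K] [Field L] [Algebra K L] [Normal K L]
    {S : Finset (HeightOneSpectrum (𝓞 K))} (ε : HS K L S → A) : Subgroup Gal(L/K) :=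
  Subgroup.map (AlgEquiv.restrictNormalHom L)
    { carrier := {s : Gal(maxAbelian K L S/K) | ∀ h, ε (conjGal s h) = ε h}
      one_mem' := fun h => rfl
      mul_mem' := fun {s t} hs ht h => (hs (conjGal t h)).trans (ht h)
      inv_mem' := fun {s} hs h => by
        have : conjGal s (conjGal s⁻¹ h) = h := by
          ext x : 1
          change s (s⁻¹ (h (s⁻¹⁻¹ (s⁻¹ x)))) = h x
          rw [inv_inv, show s (s⁻¹ x) = x from s.apply_symm_apply x]
          exact s.apply_symm_apply _
        rw [← hs (conjGal s⁻¹ h), this] }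

/-- `β ≫ 0` for an integer `β` of a totally real field `F`. -/
def IsTotallyPositive {F : Type*} [Field F] (β : 𝓞 F) : Prop :=
  ∀ φ : F →+* ℝ, 0 < φ β

/-- The integral ideal `a` of `F` is prime to the set `S` of primes of the subfield `K`. -/
def IsPrimeTo {K F : Type*} [Field K] [Field F] [Algebra K F]
    (S : Finset (HeightOneSpectrum (𝓞 K))) (a : Ideal (𝓞 F)) : Prop :=
  ∀ v ∈ S, IsCoprime a (v.asIdeal.map (algebraMap (𝓞 K) (𝓞 F)))

/-- The set `[α]_F` of pairs `(β, a)` with `0 ≪ β ∈ a ⊆ 𝓞 F`, the ideal `a` prime to `S` and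
`Tr_{F/K} β = [F : K] α`. -/
def traceSet {K : Type*} [Field K] (S : Finset (HeightOneSpectrum (𝓞 K))) (α : 𝓞 K)
    (F : Type*) [Field F] [Algebra K F] : Set (𝓞 F × Ideal (𝓞 F)) :=
  {x | IsTotallyPositive x.1 ∧ x.1 ∈ x.2 ∧ IsPrimeTo S x.2 ∧
    Algebra.trace K F (x.1 : F) = (Module.finrank K F : K) * (α : K)}

end

/-!
The pairs in `[α]_F` correspond to the points of `X = [α]_L` fixed by `Gal(L/F)`, because an
invariant ideal of `L` that is prime to the ramification is extended from `F`. Interchanging the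
two sums therefore turns the Möbius sum over the fields `F` into a sum over `y ∈ X` of Möbius sums
over the subgroups of the stabilizer `T` of `y`. The terms are constant on the orbits of
`A = Stab(ε)`, by the equivariance of the Artin symbol, and the orbit of `y` under `A` has
`|A| / |T ∩ A|` points, so it suffices that the sum attached to `y` is divisible by `|T|`. As the
norm of the ideal of `y` is a `|T|`-th power, say of `n`, that sum is, up to a factor,
`∑_H μ(H) n ^ (|T| k - [T : H])`.

The same orbit counting gives the divisibility by `|G|` of `∑_H μ(H) n ^ [G : H]`: this is the
number of colourings `G → {1, …, n}` with trivial stabilizer, on which `G` acts freely.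
-/

/-- The sum `∑_H μ_G(H) f([G : H])` over the subgroups `H` of a finite group `G`. -/
noncomputable def mobiusSum (G : Type*) {R : Type*} [Group G] [Finite G] [CommRing R]
    (f : ℕ → R) : R :=
  ∑ᶠ H : Subgroup G, (subgroupMobius G H : R) * f H.index

section Mobius

variable {G : Type*} [Group G] [Finite G] {R : Type*} [CommRing R]

open Classical in
theorem finsum_mem_Iic_subgroupMobius (H : Subgroup G) :
    ∑ᶠ T ∈ Set.Iic H, subgroupMobius G T = if H = ⊥ then 1 else 0 := by
  let : Fintype (Subgroup G) := Fintype.ofFinite _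
  let : LocallyFiniteOrder (Subgroup G) := Fintype.toLocallyFiniteOrder
  have hIic : Set.Iic H = (Finset.Icc ⊥ H : Finset (Subgroup G)) := by simp
  rw [hIic, finsum_mem_coe_finset, if_congr eq_comm rfl rfl]
  exact IncidenceAlgebra.sum_Icc_mu_right (𝕜 := ℤ) ⊥ H

theorem subgroupMobius_map {T : Type*} [Group T] [Finite T] (i : T →* G)
    (hi : Function.Injective i) (H : Subgroup T) :
    subgroupMobius G (H.map i) = subgroupMobius T H := by
  induction H using WellFoundedLT.induction with | ind H ih =>
  have hIio : Set.Iio (H.map i) = Subgroup.map i '' Set.Iio H := by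
    ext U
    refine ⟨fun hU => ?_, ?_⟩
    · have hmap : (U.comap i).map i = U :=
        Subgroup.map_comap_eq_self (hU.le.trans (Subgroup.map_le_range i H))
      exact ⟨U.comap i, (Subgroup.map_lt_map_iff_of_injective hi).1 (hmap.symm ▸ hU), hmap⟩
    · rintro ⟨V, hV, rfl⟩
      exact (Subgroup.map_lt_map_iff_of_injective hi).2 hV
  have hG := finsum_mem_Iic_subgroupMobius (H.map i)
  have hT := finsum_mem_Iic_subgroupMobius H
  rw [← Set.Iio_insert, finsum_mem_insert _ Set.self_notMem_Iio (Set.toFinite _)] at hG hT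
  rw [Subgroup.map_eq_bot_iff_of_injective H hi, ← hT, hIio,
    finsum_mem_image (Subgroup.map_injective hi).injOn,
    finsum_mem_congr (t := Set.Iio H) rfl ih] at hG
  exact add_right_cancel hG

theorem mobiusSum_congr {T : Type*} [Group T] [Finite T] (e : G ≃* T) (f : ℕ → R) :
    mobiusSum G f = mobiusSum T f := by
  refine finsum_eq_of_bijective _ e.mapSubgroup.bijective fun H => ?_
  change _ = (subgroupMobius T (H.map (e : G →* T)) : R) * f (H.map (e : G →* T)).index
  rw [subgroupMobius_map _ e.injective, Subgroup.index_map_equiv]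

theorem mobiusSum_const_mul (c : R) (f : ℕ → R) :
    mobiusSum G (fun i => c * f i) = c * mobiusSum G f := by
  rw [mobiusSum, mobiusSum, mul_finsum' _ _ (Set.toFinite _)]
  exact finsum_congr fun H => mul_left_comm ..

theorem dvd_mobiusSum_sub {m : R} {f g : ℕ → R} (h : ∀ H : Subgroup G, m ∣ f H.index - g H.index) :
    m ∣ mobiusSum G f - mobiusSum G g := by
  rw [mobiusSum, mobiusSum, ← finsum_sub_distrib (Set.toFinite _) (Set.toFinite _)]
  simp only [← mul_sub]
  exact finsum_induction (m ∣ ·) (dvd_zero m) (fun _ _ => dvd_add) fun H => (h H).mul_left _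

theorem finsum_mem_Iic_mul_relIndex (T : Subgroup G) (f : ℕ → R) :
    ∑ᶠ H ∈ Set.Iic T, (subgroupMobius G H : R) * f (H.relIndex T) = mobiusSum T f := by
  have hbij : Set.BijOn (fun H : Subgroup T => H.map T.subtype) Set.univ (Set.Iic T) :=
    ⟨fun H _ => Subgroup.map_subtype_le H, (Subgroup.map_injective T.subtype_injective).injOn,
      fun H hH => ⟨H.subgroupOf T, trivial, Subgroup.map_subgroupOf_eq_of_le hH⟩⟩
  symm
  rw [mobiusSum, ← finsum_mem_univ]
  refine finsum_mem_eq_of_bijOn _ hbij fun H _ => ?_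
  rw [subgroupMobius_map _ T.subtype_injective, Subgroup.relIndex, Subgroup.subgroupOf,
    Subgroup.comap_map_eq_self_of_injective T.subtype_injective]

theorem natCard_dvd_mobiusSum_one : (Nat.card G : R) ∣ mobiusSum G fun _ => 1 := by
  have hsum : mobiusSum G (fun _ => (1 : R)) = Int.castAddHom R (∑ᶠ H, subgroupMobius G H) := by
    rw [AddMonoidHom.map_finsum _ (Set.toFinite _)]
    exact finsum_congr fun H => mul_one _
  have htop := finsum_mem_Iic_subgroupMobius (⊤ : Subgroup G)
  rw [Set.Iic_top, finsum_mem_univ] at htop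
  rw [hsum, htop]
  split_ifs with h
  · rw [← Subgroup.card_top, h, Subgroup.card_bot, Nat.cast_one]
    exact one_dvd _
  · rw [map_zero]
    exact dvd_zero _

end Mobius

section Orbits

variable {G X R : Type*} [Group G] [MulAction G X] [Finite X] [CommRing R]

theorem natCard_dvd_finsum_of_natCard_stabilizer_dvd {f : X → R}
    (hf : ∀ (g : G) (x : X), f (g • x) = f x)
    (hstab : ∀ x, (Nat.card (MulAction.stabilizer G x) : R) ∣ f x) :
    (Nat.card G : R) ∣ ∑ᶠ x, f x := by
  classical
  have := Fintype.ofFinite X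
  rw [finsum_eq_sum_of_fintype,
    ← Finset.sum_fiberwise Finset.univ (Quotient.mk (MulAction.orbitRel G X))]
  refine Finset.dvd_sum fun ω _ => ?_
  induction ω using Quotient.inductionOn with | _ x =>
  have horbit (y : X) : y ∈ ({y | ⟦y⟧ = Quotient.mk (MulAction.orbitRel G X) x} : Finset X) ↔
      y ∈ MulAction.orbit G x := by
    simp only [Finset.mem_filter_univ, Quotient.eq, MulAction.orbitRel_apply]
  have hconst : ∀ y ∈ ({y | ⟦y⟧ = Quotient.mk (MulAction.orbitRel G X) x} : Finset X),
      f y = f x := fun y hy => by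
    obtain ⟨g, rfl⟩ := (horbit y).1 hy
    exact hf g x
  rw [Finset.sum_congr rfl hconst, Finset.sum_const, nsmul_eq_mul, ← Set.ncard_coe_finset,
    Set.ext horbit, ← MulAction.index_stabilizer, ← (MulAction.stabilizer G x).index_mul_card,
    Nat.cast_mul]
  exact mul_dvd_mul_left _ (hstab x)

variable [Finite G]

theorem finsum_mobius_mul_finsum_fixedPoints (f : X → ℕ → R) :
    ∑ᶠ H : Subgroup G, (subgroupMobius G H : R) *
        ∑ᶠ x ∈ MulAction.fixedPoints H X, f x (H.relIndex (MulAction.stabilizer G x)) =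
      ∑ᶠ x : X, mobiusSum (MulAction.stabilizer G x) (f x) := by
  classical
  have := Fintype.ofFinite X
  have := Fintype.ofFinite (Subgroup G)
  have hmem (H : Subgroup G) (x : X) :
      x ∈ MulAction.fixedPoints H X ↔ H ∈ Set.Iic (MulAction.stabilizer G x) :=
    ⟨fun hx g hg => hx ⟨g, hg⟩, fun hH g => hH g.2⟩
  simp only [← finsum_mem_Iic_mul_relIndex, finsum_mem_def, Set.indicator_apply]
  simp only [finsum_eq_sum_of_fintype, hmem, Finset.mul_sum, mul_ite, mul_zero]
  exact Finset.sum_comm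

theorem natCard_dvd_finsum_mobius_mul_finsum_fixedPoints (A : Subgroup G) {f : X → ℕ → R}
    (hf : ∀ a ∈ A, ∀ x, f (a • x) = f x)
    (hstab : ∀ x, (Nat.card (MulAction.stabilizer G x) : R) ∣
      mobiusSum (MulAction.stabilizer G x) (f x)) :
    (Nat.card A : R) ∣ ∑ᶠ H : Subgroup G, (subgroupMobius G H : R) *
      ∑ᶠ x ∈ MulAction.fixedPoints H X, f x (H.relIndex (MulAction.stabilizer G x)) := by
  rw [finsum_mobius_mul_finsum_fixedPoints]
  refine natCard_dvd_finsum_of_natCard_stabilizer_dvd (G := A) (fun a x => ?_) fun x => ?_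
  · change mobiusSum (MulAction.stabilizer G ((a : G) • x)) (f ((a : G) • x)) = _
    rw [hf a a.2]
    exact mobiusSum_congr (MulAction.stabilizerEquivStabilizer rfl).symm _
  · have hcard : Nat.card (MulAction.stabilizer A x) ∣ Nat.card (MulAction.stabilizer G x) := by
      rw [← Subgroup.card_map_of_injective A.subtype_injective]
      refine Subgroup.card_dvd_of_le ?_
      rintro _ ⟨a, ha, rfl⟩
      exact ha
    exact (Nat.cast_dvd_cast hcard).trans (hstab x)

end Orbits

section Colourings

attribute [local instance] arrowAction

variable {G : Type*} [Group G]

theorem mem_fixedPoints_arrow_iff {B : Type*} {f : G → B} {H : Subgroup G} :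
    f ∈ MulAction.fixedPoints H (G → B) ↔ ∀ h : H, ∀ x, f (h * x) = f x := by
  refine ⟨fun hf h x => ?_, fun hf h => funext fun x => hf h⁻¹ x⟩
  have hx : f ((h : G)⁻¹⁻¹ * x) = f x := congrFun (hf h⁻¹) x
  rwa [inv_inv] at hx

theorem ncard_fixedPoints_arrow [Finite G] (B : Type*) (H : Subgroup G) :
    (MulAction.fixedPoints H (G → B)).ncard = Nat.card B ^ H.index := by
  let e : MulAction.fixedPoints H (G → B) ≃ (Quotient (QuotientGroup.rightRel H) → B) :=
    { toFun f := Quotient.lift f.1 fun _ b ⟨h, hb⟩ => hb ▸ mem_fixedPoints_arrow_iff.1 f.2 h b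
      invFun g := ⟨fun x => g ⟦x⟧, mem_fixedPoints_arrow_iff.2 fun h _ =>
        congrArg g (Quotient.sound ⟨h, rfl⟩)⟩
      left_inv _ := rfl
      right_inv g := funext fun q => q.inductionOn fun _ => rfl }
  rw [← Nat.card_coe_set_eq, Nat.card_congr e, Nat.card_fun,
    Nat.card_congr (QuotientGroup.quotientRightRelEquivQuotientLeftRel H), Subgroup.index]

theorem natCard_dvd_mobiusSum_natCast_pow [Finite G] {R : Type*} [CommRing R] (n : ℕ) :
    (Nat.card G : R) ∣ mobiusSum G fun i => (n : R) ^ i := by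
  have hfix (H : Subgroup G) :
      ∑ᶠ _ ∈ MulAction.fixedPoints H (G → Fin n), (1 : R) = (n : R) ^ H.index := by
    rw [finsum_mem_eq_finite_toFinset_sum _ (Set.toFinite _), Finset.sum_const, nsmul_one,
      ← Set.ncard_eq_toFinset_card, ncard_fixedPoints_arrow, Nat.card_fin, Nat.cast_pow]
  have h := natCard_dvd_finsum_mobius_mul_finsum_fixedPoints (X := G → Fin n) (R := R)
    (⊤ : Subgroup G) (f := fun _ _ => 1) (fun _ _ _ => rfl) fun _ => natCard_dvd_mobiusSum_one
  simpa only [Subgroup.card_top, hfix, mobiusSum] using h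

end Colourings

section PowerResidues

theorem exists_pos_forall_pow_add_mul_eq {M : Type*} [Monoid M] [Finite M] (x : M) :
    ∃ d : ℕ, 0 < d ∧ ∀ a, Nat.card M ≤ a → ∀ i, x ^ (a + d * i) = x ^ a := by
  obtain ⟨i, j, hij, hpow⟩ : ∃ i j : Fin (Nat.card M + 1), i < j ∧ x ^ (i : ℕ) = x ^ (j : ℕ) := by
    have := Fintype.ofFinite M
    obtain ⟨i, j, hne, hpow⟩ := Fintype.exists_ne_map_eq_of_card_lt
      (fun i : Fin (Nat.card M + 1) => x ^ (i : ℕ)) (by simp [Nat.card_eq_fintype_card])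
    rcases hne.lt_or_gt with h | h
    exacts [⟨i, j, h, hpow⟩, ⟨j, i, h, hpow.symm⟩]
  refine ⟨j - i, Nat.sub_pos_of_lt hij, fun a ha m => ?_⟩
  induction m with
  | zero => rw [mul_zero, add_zero]
  | succ m ih =>
    rw [← ih]
    set b := a + (j - i : ℕ) * m
    have hb : a ≤ b := Nat.le_add_right _ _
    have hstep : a + (j - i : ℕ) * (m + 1) = (b - i) + j := by
      rw [mul_add_one, ← add_assoc]
      omega
    rw [hstep, pow_add, ← hpow, ← pow_add]
    congr 1
    omega

theorem exists_pos_forall_dvd_pow_add_mul_sub_pow {m : ℕ} (hm : m ≠ 0) (n : ℤ) :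
    ∃ d : ℕ, 0 < d ∧ ∀ a, m ≤ a → ∀ i, (m : ℤ) ∣ n ^ (a + d * i) - n ^ a := by
  have : NeZero m := ⟨hm⟩
  obtain ⟨d, hd, hpow⟩ := exists_pos_forall_pow_add_mul_eq (n : ZMod m)
  refine ⟨d, hd, fun a ha i => (ZMod.intCast_zmod_eq_zero_iff_dvd _ _).1 ?_⟩
  rw [Int.cast_sub, Int.cast_pow, Int.cast_pow, hpow a ((Nat.card_zmod m).trans_le ha),
    sub_self]

theorem exists_natCast_dvd_sub {A : Type*} [CommRing A] [Algebra ℤ A] (M : Submonoid ℤ)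
    [IsLocalization M A] {m : ℕ} (hm : m ≠ 0) (r : A) : ∃ n : ℕ, (m : A) ∣ r - n := by
  obtain ⟨a, s, rfl⟩ := IsLocalization.exists_mk'_eq M r
  obtain ⟨d, hd, hpow⟩ := exists_pos_forall_dvd_pow_add_mul_sub_pow hm (s : ℤ)
  have hs : IsUnit ((s : ℤ) : A) := by simpa using IsLocalization.map_units A s
  have hinv : (m : A) ∣ ((s : ℤ) : A) ^ d - 1 := by
    have h := map_dvd (Int.castRingHom A) (hpow m le_rfl 1)
    rw [mul_one, pow_add, ← mul_sub_one, map_mul] at h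
    simpa using (IsUnit.dvd_mul_left (by simpa using hs.pow m)).1 h
  obtain ⟨n, hn⟩ : ∃ n : ℕ, (m : ℤ) ∣ a * s ^ (d - 1) - n :=
    ⟨((a * s ^ (d - 1)) % m).toNat, by
      rw [Int.toNat_of_nonneg (Int.emod_nonneg _ (Int.natCast_ne_zero.2 hm))]
      exact Int.dvd_self_sub_emod⟩
  refine ⟨n, (hs.dvd_mul_right).1 ?_⟩
  have hr : IsLocalization.mk' A a s * ((s : ℤ) : A) = a := by
    simpa using IsLocalization.mk'_spec A a s
  have hn' : (m : A) ∣ (a : A) * ((s : ℤ) : A) ^ (d - 1) - n := by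
    simpa using map_dvd (Int.castRingHom A) hn
  have hsplit : (IsLocalization.mk' A a s - n) * ((s : ℤ) : A) =
      ((a : A) * ((s : ℤ) : A) ^ (d - 1) - n) * ((s : ℤ) : A) -
        (a : A) * (((s : ℤ) : A) ^ d - 1) := by
    rw [sub_mul, hr, ← pow_sub_one_mul hd.ne']
    ring
  exact hsplit ▸ (hn'.mul_right _).sub (hinv.mul_left _)

end PowerResidues

section MobiusPower

variable {G : Type*} [Group G] [Finite G]

theorem natCard_dvd_mobiusSum_pow {A : Type*} [CommRing A] [Algebra ℤ A] (M : Submonoid ℤ)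
    [IsLocalization M A] (r : A) : (Nat.card G : A) ∣ mobiusSum G fun i => r ^ i := by
  obtain ⟨n, hn⟩ := exists_natCast_dvd_sub M (m := Nat.card G) Nat.card_pos.ne' r
  refine (dvd_sub_left (natCard_dvd_mobiusSum_natCast_pow n)).1 (dvd_mobiusSum_sub fun H => ?_)
  exact hn.trans (sub_dvd_pow_sub_pow r n _)

/- Powers of `n` modulo `|G|` are eventually periodic, with period `d` say, so that `n ^ (d - 1)`
replaces the possibly missing inverse of `n`. -/
theorem natCard_dvd_mobiusSum_pow_sub {R : Type*} [CommRing R] {k : ℕ} (hk : 2 ≤ k) (n : ℕ) :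
    (Nat.card G : R) ∣ mobiusSum G fun i => (n : R) ^ (Nat.card G * k - i) := by
  obtain ⟨d, hd, hpow⟩ := exists_pos_forall_dvd_pow_add_mul_sub_pow
    (m := Nat.card G) Nat.card_pos.ne' (n : ℤ)
  have hmain : (Nat.card G : R) ∣
      mobiusSum G fun i => (n : R) ^ (Nat.card G * k) * ((n ^ (d - 1) : ℕ) : R) ^ i := by
    rw [mobiusSum_const_mul]
    exact (natCard_dvd_mobiusSum_natCast_pow _).mul_left _
  refine (dvd_sub_right hmain).1 (dvd_mobiusSum_sub fun H => ?_)
  have hH : H.index ≤ Nat.card G := Nat.le_of_dvd Nat.card_pos H.index_dvd_card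
  have hcard : Nat.card G + H.index ≤ Nat.card G * k := by nlinarith
  have hexp : Nat.card G * k + (d - 1) * H.index =
      (Nat.card G * k - H.index) + d * H.index := by
    obtain ⟨c, rfl⟩ := Nat.exists_eq_succ_of_ne_zero hd.ne'
    rw [Nat.succ_sub_one, Nat.succ_mul]
    omega
  rw [Nat.cast_pow, ← pow_mul, ← pow_add, hexp]
  simpa using map_dvd (Int.castRingHom R) (hpow _ (Nat.le_sub_of_add_le hcard) H.index)

theorem natCard_dvd_finsum_mobius_mul_finsum_fixedPoints_mul_pow {X R : Type*} [MulAction G X]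
    [Finite X] [CommRing R] (A : Subgroup G) {ε : X → R} (hε : ∀ a ∈ A, ∀ x, ε (a • x) = ε x)
    {n : X → ℕ} (hn : ∀ (g : G) (x : X), n (g • x) = n x) {k : ℕ} (hk : 2 ≤ k) :
    (Nat.card A : R) ∣ ∑ᶠ H : Subgroup G, (subgroupMobius G H : R) *
      ∑ᶠ x ∈ MulAction.fixedPoints H X, ε x * (n x : R) ^
        (Nat.card (MulAction.stabilizer G x) * k - H.relIndex (MulAction.stabilizer G x)) := by
  refine natCard_dvd_finsum_mobius_mul_finsum_fixedPoints A
    (f := fun x i => ε x * (n x : R) ^ (Nat.card (MulAction.stabilizer G x) * k - i))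
    (fun a ha x => ?_) fun x => ?_
  · have hcard := Nat.card_congr (MulAction.stabilizerEquivStabilizer (rfl : a • x = a • x)).toEquiv
    rw [hε a ha, hn, hcard]
  · rw [mobiusSum_const_mul]
    exact (natCard_dvd_mobiusSum_pow_sub hk (n x)).mul_left _

end MobiusPower

section Ideals

open UniqueFactorizationMonoid

theorem map_algebraMap_injective_of_faithfullyFlat {A B : Type*} [CommRing A] [CommRing B]
    [Algebra A B] [Module.FaithfullyFlat A B] :
    Function.Injective fun a : Ideal A => a.map (algebraMap A B) :=
  Function.LeftInverse.injective fun a => Ideal.comap_map_eq_self_of_faithfullyFlat (B := B) a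

theorem smul_map_algebraMap {A B G : Type*} [CommRing A] [CommRing B] [Algebra A B] [Group G]
    [MulSemiringAction G B] [SMulCommClass G A B] (g : G) (a : Ideal A) :
    g • a.map (algebraMap A B) = a.map (algebraMap A B) := by
  rw [Ideal.pointwise_smul_def, Ideal.map_map]
  congr 1
  ext x
  exact smul_algebraMap g x

theorem natCard_quotient_smul {G A : Type*} [Group G] [CommRing A] [MulSemiringAction G A]
    (g : G) (b : Ideal A) : Nat.card (A ⧸ g • b) = Nat.card (A ⧸ b) :=
  Nat.card_congr (Ideal.quotientEquiv b (g • b)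
    (MulSemiringAction.toRingEquiv G A g) rfl).symm.toEquiv

theorem normalizedFactors_smul {G A : Type*} [Group G] [CommRing A] [IsDedekindDomain A]
    [MulSemiringAction G A] (g : G) (b : Ideal A) :
    normalizedFactors (g • b) = (normalizedFactors b).map (g • ·) := by
  rcases eq_or_ne b ⊥ with rfl | hb
  · rw [Ideal.smul_bot, ← Ideal.zero_eq_bot, normalizedFactors_zero, Multiset.map_zero]
  have hprod : ((normalizedFactors b).map (g • ·)).prod = g • b := by
    conv_rhs => rw [← Ideal.prod_normalizedFactors_eq_self hb]
    exact (map_multiset_prod (MulDistribMulAction.toMonoidHom (Ideal A) g) _).symm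
  rw [← hprod]
  refine normalizedFactors_prod_of_prime fun P hP => ?_
  obtain ⟨Q, hQ, rfl⟩ := Multiset.mem_map.1 hP
  have hQprime := prime_of_normalized_factor Q hQ
  have := Ideal.isPrime_of_prime hQprime
  refine Ideal.prime_of_isPrime (fun h => hQprime.ne_zero ?_) inferInstance
  rw [Ideal.zero_eq_bot, ← inv_smul_smul g Q, h, Ideal.smul_bot]

variable {A B : Type*} [CommRing A] [CommRing B] [IsDedekindDomain A] [IsDedekindDomain B]
  [Algebra A B] [Module.Finite A B] [Module.IsTorsionFree A B]

open Classical in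
theorem count_normalizedFactors_map_eq_one {q : Ideal A} (hq : q ≠ ⊥) (Q : Ideal B)
    [Q.IsPrime] [Q.LiesOver q] [Algebra.IsUnramifiedAt A Q] :
    (normalizedFactors (q.map (algebraMap A B))).count Q = 1 := by
  rw [← Ideal.IsDedekindDomain.ramificationIdx'_eq_normalizedFactors_count
    (Ideal.map_ne_bot_of_ne_bot hq) inferInstance (Ideal.ne_bot_of_liesOver_of_ne_bot hq Q),
    Ideal.ramificationIdx'_eq_ramificationIdx q Q hq, Ideal.ramificationIdx_eq_one]

variable (G : Type*) [Group G] [Finite G] [MulSemiringAction G B] [IsGaloisGroup G A B]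

theorem le_map_under_of_smul_eq {b : Ideal B} (hG : ∀ g : G, g • b = b)
    (hunr : ∀ (P : Ideal B) [P.IsPrime], P ≠ ⊥ → b ≤ P → Algebra.IsUnramifiedAt A P)
    {P : Ideal B} [P.IsPrime] (hP : P ≠ ⊥) (hbP : b ≤ P) :
    b ≤ (P.under A).map (algebraMap A B) := by
  classical
  rcases eq_or_ne b ⊥ with rfl | hb
  · exact bot_le
  set q := P.under A
  have hq0 : q ≠ ⊥ := fun h => hP (Ideal.eq_bot_of_comap_eq_bot h)
  rw [← Ideal.dvd_iff_le, dvd_iff_normalizedFactors_le_normalizedFactors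
    (Ideal.map_ne_bot_of_ne_bot hq0) hb, Multiset.le_iff_count]
  intro Q
  by_cases hQ : Q ∈ normalizedFactors (q.map (algebraMap A B))
  swap
  · rw [Multiset.count_eq_zero_of_notMem hQ]
    exact Nat.zero_le _
  have : q.IsMaximal := Ring.DimensionLEOne.maximalOfPrime hq0 inferInstance
  obtain ⟨hQp, hQq⟩ : Q ∈ q.primesOver B :=
    (Ideal.mem_primesOver_iff_mem_normalizedFactors B hq0).2 hQ
  have hQ0 : Q ≠ ⊥ := Ideal.ne_bot_of_liesOver_of_ne_bot hq0 Q
  obtain ⟨g, hg⟩ := Ideal.exists_smul_eq_of_isGaloisGroup q P Q G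
  have hbQ : b ≤ Q := by
    rw [← hg, ← hG g]
    exact Ideal.pointwise_smul_le_pointwise_smul_iff.2 hbP
  have := hunr Q hQ0 hbQ
  rw [count_normalizedFactors_map_eq_one hq0, Multiset.one_le_count_iff_mem,
    mem_normalizedFactors_iff hb]
  exact ⟨Ideal.prime_of_isPrime hQ0 hQp, Ideal.dvd_iff_le.2 hbQ⟩

theorem exists_map_eq_of_smul_eq {b : Ideal B} (hG : ∀ g : G, g • b = b)
    (hunr : ∀ (P : Ideal B) [P.IsPrime], P ≠ ⊥ → b ≤ P → Algebra.IsUnramifiedAt A P) :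
    ∃ a : Ideal A, a.map (algebraMap A B) = b := by
  induction b using WellFoundedGT.induction with | ind b ih =>
  rcases eq_or_ne b ⊥ with rfl | hb
  · exact ⟨⊥, Ideal.map_bot⟩
  rcases eq_or_ne b ⊤ with rfl | hbtop
  · exact ⟨⊤, Ideal.map_top _⟩
  obtain ⟨P, hPmax, hbP⟩ := Ideal.exists_le_maximal b hbtop
  have hP0 : P ≠ ⊥ := fun h => hb (le_bot_iff.1 (h ▸ hbP))
  set q := P.under A
  obtain ⟨c, rfl⟩ := Ideal.dvd_iff_le.2 (le_map_under_of_smul_eq G hG hunr hP0 hbP)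
  have hq0 : q.map (algebraMap A B) ≠ 0 := left_ne_zero_of_mul hb
  have hc0 : c ≠ 0 := right_ne_zero_of_mul hb
  have hlt : q.map (algebraMap A B) * c < c :=
    lt_of_le_of_ne Ideal.mul_le_right fun h => hPmax.ne_top <| (Ideal.eq_top_iff_one P).2 <|
      Submodule.one_le.1 (((mul_eq_right₀ hc0).1 h).ge.trans Ideal.map_comap_le)
  have hcG (g : G) : g • c = c := by
    have h := hG g
    rw [smul_mul', smul_map_algebraMap] at h
    exact mul_left_cancel₀ hq0 h
  obtain ⟨a, rfl⟩ := ih c hlt hcG fun Q _ hQ0 hQ => hunr Q hQ0 (hlt.le.trans hQ)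
  exact ⟨q * a, Ideal.map_mul _ _ _⟩

end Ideals

section TotallyPositive

variable {F L : Type*} [Field F] [Field L]

theorem exists_ofRealHom_comp_eq [IsTotallyReal F] (φ : F →+* ℂ) :
    ∃ ψ : F →+* ℝ, Complex.ofRealHom.comp ψ = φ :=
  have h := IsTotallyReal.complexEmbedding_isReal φ
  ⟨h.embedding, RingHom.ext h.coe_embedding_apply⟩

theorem exists_comp_algebraMap_eq [IsTotallyReal L] [Algebra F L] [Algebra.IsAlgebraic F L]
    (φ : F →+* ℝ) : ∃ ψ : L →+* ℝ, ψ.comp (algebraMap F L) = φ := by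
  obtain ⟨ψ, hψ⟩ := exists_ofRealHom_comp_eq (ComplexEmbedding.lift L (Complex.ofRealHom.comp φ))
  refine ⟨ψ, RingHom.ext fun x => Complex.ofReal_injective ?_⟩
  have hx := ComplexEmbedding.lift_algebraMap_apply L (Complex.ofRealHom.comp φ) x
  rwa [← hψ] at hx

namespace IsTotallyPositive

variable {β : 𝓞 F}

theorem map [Algebra F L] (h : IsTotallyPositive β) :
    IsTotallyPositive (algebraMap (𝓞 F) (𝓞 L) β) :=
  fun φ => h (φ.comp (algebraMap F L))

theorem of_map [IsTotallyReal L] [Algebra F L] [Algebra.IsAlgebraic F L]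
    (h : IsTotallyPositive (algebraMap (𝓞 F) (𝓞 L) β)) : IsTotallyPositive β := fun φ => by
  obtain ⟨ψ, rfl⟩ := exists_comp_algebraMap_eq (L := L) φ
  exact h ψ

theorem exists_pos [IsTotallyReal F] (h : IsTotallyPositive β) (φ : F →+* ℂ) :
    ∃ r : ℝ, 0 < r ∧ φ (β : F) = r := by
  obtain ⟨ψ, rfl⟩ := exists_ofRealHom_comp_eq φ
  exact ⟨ψ β, h ψ, rfl⟩

variable [NumberField F] [IsTotallyReal F]

theorem ne_zero (h : IsTotallyPositive β) : β ≠ 0 := by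
  rintro rfl
  obtain ⟨ψ, -⟩ := exists_ofRealHom_comp_eq (Classical.arbitrary (F →+* ℂ))
  exact (h ψ).ne' (map_zero ψ)

theorem norm_le_trace (h : IsTotallyPositive β) (φ : F →+* ℂ) :
    ‖φ (β : F)‖ ≤ (Algebra.trace ℚ F (β : F) : ℝ) := by
  choose r hr hφ using h.exists_pos
  have htrace : (Algebra.trace ℚ F (β : F) : ℝ) = ∑ σ : F →ₐ[ℚ] ℂ, r σ := by
    have hsum := trace_eq_sum_embeddings (K := ℚ) (L := F) ℂ (x := (β : F))
    have hre := congrArg Complex.re (hsum.trans (Finset.sum_congr rfl fun σ _ => hφ σ))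
    simpa using hre
  rw [hφ, Complex.norm_real, Real.norm_of_nonneg (hr φ).le, htrace]
  exact Finset.single_le_sum (f := fun σ : F →ₐ[ℚ] ℂ => r σ) (fun σ _ => (hr σ).le)
    (Finset.mem_univ φ.toRatAlgHom)

end IsTotallyPositive

end TotallyPositive

section PrimeTo

instance smulCommClass_gal_ringOfIntegers {K L : Type*} [Field K] [Field L] [Algebra K L] :
    SMulCommClass Gal(L/K) (𝓞 K) (𝓞 L) where
  smul_comm σ a x := by
    have ha : σ • algebraMap (𝓞 K) (𝓞 L) a = algebraMap (𝓞 K) (𝓞 L) a :=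
      RingOfIntegers.ext (σ.commutes a)
    rw [Algebra.smul_def, Algebra.smul_def, smul_mul', ha]

variable {K F L : Type*} [Field K] [Field F] [Field L] [Algebra K F] [Algebra K L]
  {S : Finset (HeightOneSpectrum (𝓞 K))}

namespace IsPrimeTo

theorem map_iff [Algebra F L] [IsScalarTower K F L] [NumberField F]
    {a : Ideal (𝓞 F)} :
    IsPrimeTo S (a.map (algebraMap (𝓞 F) (𝓞 L))) ↔ IsPrimeTo S a := by
  refine forall₂_congr fun v _ => ?_
  have hv : v.asIdeal.map (algebraMap (𝓞 K) (𝓞 L)) =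
      (v.asIdeal.map (algebraMap (𝓞 K) (𝓞 F))).map (algebraMap (𝓞 F) (𝓞 L)) := by
    rw [Ideal.map_map, ← IsScalarTower.algebraMap_eq]
  rw [hv, Ideal.isCoprime_iff_sup_eq, Ideal.isCoprime_iff_sup_eq, ← Ideal.map_sup]
  exact (map_algebraMap_injective_of_faithfullyFlat (B := 𝓞 L)).eq_iff' (Ideal.map_top _)

theorem smul {b : Ideal (𝓞 L)} (h : IsPrimeTo S b) (σ : Gal(L/K)) : IsPrimeTo S (σ • b) :=
  fun v hv => by
    rw [Ideal.isCoprime_iff_sup_eq, ← smul_map_algebraMap σ v.asIdeal,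
      Ideal.pointwise_smul_def, Ideal.pointwise_smul_def, ← Ideal.map_sup,
      Ideal.isCoprime_iff_sup_eq.1 (h v hv), Ideal.map_top]

theorem not_liesOver {b P : Ideal (𝓞 L)} (hb : IsPrimeTo S b) (hP : P ≠ ⊤) (hbP : b ≤ P) :
    ∀ v ∈ S, ¬ P.LiesOver v.asIdeal := fun v hv h => by
  refine hP (top_le_iff.1 (Ideal.isCoprime_iff_sup_eq.1 (hb v hv) ▸ sup_le hbP ?_))
  rw [Ideal.map_le_iff_le_comap, h.over]

end IsPrimeTo

end PrimeTo

section TraceSet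

theorem trace_algebraMap_eq_finrank_mul_trace {K F L : Type*} [Field K] [Field F] [Field L]
    [Algebra K F] [Algebra K L] [Algebra F L] [IsScalarTower K F L] [FiniteDimensional K F]
    [FiniteDimensional F L] (x : F) :
    Algebra.trace K L (algebraMap F L x) = (Module.finrank F L : K) * Algebra.trace K F x := by
  rw [← Algebra.trace_trace (S := F), Algebra.trace_algebraMap, map_nsmul, nsmul_eq_mul]

variable {K F L : Type*} [Field K] [Field F] [Field L] [Algebra K F] [Algebra K L]
  (S : Finset (HeightOneSpectrum (𝓞 K))) (α : 𝓞 K)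

/-- The set `[α]_L` with the action `(β, b) ↦ (σ β, σ b)` of `Gal(L/K)`. -/
def traceSubMulAction (L : Type*) [Field L] [Algebra K L] :
    SubMulAction Gal(L/K) (𝓞 L × Ideal (𝓞 L)) where
  carrier := traceSet S α L
  smul_mem' σ y hy :=
    ⟨fun φ => hy.1 (φ.comp (σ : L →+* L)), Ideal.smul_mem_pointwise_smul _ _ _ hy.2.1,
      hy.2.2.1.smul σ, (Algebra.trace_eq_of_algEquiv σ (y.1 : L)).trans hy.2.2.2⟩

variable [NumberField K] [NumberField F] [NumberField L]

theorem traceSet_finite [IsTotallyReal F] : (traceSet S α F).Finite := by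
  set B : ℝ := ((Algebra.trace ℚ K ((Module.finrank K F : K) * (α : K)) : ℚ) : ℝ)
  have hfin : {β : 𝓞 F | β ≠ 0 ∧ ∀ φ : F →+* ℂ, ‖φ β‖ ≤ B}.Finite :=
    ((Embeddings.finite_of_norm_le F ℂ B).preimage RingOfIntegers.coe_injective.injOn).subset
      fun β hβ => ⟨β.isIntegral_coe, hβ.2⟩
  refine (hfin.biUnion (t := fun β => Prod.mk β '' {a | β ∈ a}) fun β hβ =>
    (Ring.HasFiniteQuotients.finite_setOfPred_mem β hβ.1).image _).subset ?_
  rintro ⟨β, a⟩ ⟨hpos, hmem, -, htr⟩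
  refine Set.mem_biUnion (x := β) ⟨hpos.ne_zero, fun φ => ?_⟩ ⟨a, hmem, rfl⟩
  simp only [B, ← htr, Algebra.trace_trace]
  exact hpos.norm_le_trace φ

variable {S α}

theorem mk_map_mem_traceSet_iff [IsTotallyReal L] [Algebra F L] [IsScalarTower K F L] {β : 𝓞 F}
    {a : Ideal (𝓞 F)} :
    (algebraMap (𝓞 F) (𝓞 L) β, a.map (algebraMap (𝓞 F) (𝓞 L))) ∈ traceSet S α L ↔
      (β, a) ∈ traceSet S α F := by
  refine and_congr ⟨.of_map, .map⟩ (and_congr ?_ (and_congr IsPrimeTo.map_iff ?_))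
  · rw [← Ideal.mem_comap, Ideal.comap_map_eq_self_of_faithfullyFlat]
  · change Algebra.trace K L (algebraMap F L (β : F)) = _ ↔ _
    have hdeg : (Module.finrank F L : K) ≠ 0 := Nat.cast_ne_zero.2 Module.finrank_pos.ne'
    rw [trace_algebraMap_eq_finrank_mul_trace, ← Module.finrank_mul_finrank K F L, Nat.cast_mul,
      mul_comm (Module.finrank K F : K), mul_assoc, mul_right_inj' hdeg]

theorem exists_mem_traceSet_of_smul_eq [IsTotallyReal L] [Algebra F L] [IsScalarTower K F L]
    [IsGalois F L] (hSram : IsUnramifiedOutside K K L S) {y : 𝓞 L × Ideal (𝓞 L)}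
    (hy : y ∈ traceSet S α L) (hfix : ∀ τ : Gal(L/F), τ • y = y) :
    ∃ x ∈ traceSet S α F,
      (algebraMap (𝓞 F) (𝓞 L) x.1, x.2.map (algebraMap (𝓞 F) (𝓞 L))) = y := by
  obtain ⟨β, b⟩ := y
  obtain ⟨β, rfl⟩ : ∃ β' : 𝓞 F, algebraMap (𝓞 F) (𝓞 L) β' = β :=
    Algebra.IsInvariant.isInvariant (G := Gal(L/F)) β fun τ => congrArg Prod.fst (hfix τ)
  obtain ⟨a, rfl⟩ := exists_map_eq_of_smul_eq (A := 𝓞 F) Gal(L/F)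
    (fun τ => congrArg Prod.snd (hfix τ)) fun P hP hP0 hbP => by
      have := hSram ⟨P, hP, hP0⟩ (hy.2.2.1.not_liesOver hP.ne_top hbP)
      exact Algebra.IsUnramifiedAt.of_restrictScalars (𝓞 K) P
  exact ⟨(β, a), mk_map_mem_traceSet_iff.1 hy, rfl⟩

theorem bijOn_traceSet [IsTotallyReal L] [IsGalois K L] (hSram : IsUnramifiedOutside K K L S)
    (F : IntermediateField K L) :
    Set.BijOn
      (fun x : 𝓞 F × Ideal (𝓞 F) =>
        (algebraMap (𝓞 F) (𝓞 L) x.1, x.2.map (algebraMap (𝓞 F) (𝓞 L))))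
      (traceSet S α F)
      {y ∈ traceSet S α L | ∀ σ ∈ F.fixingSubgroup, σ • y = y} := by
  refine ⟨fun x hx => ⟨mk_map_mem_traceSet_iff.2 hx, fun σ hσ => ?_⟩, fun x _ y _ h => ?_,
    fun y ⟨hy, hfix⟩ => exists_mem_traceSet_of_smul_eq hSram hy fun τ =>
      hfix (τ.restrictScalars K) (F.fixingSubgroupEquiv.symm τ).2⟩
  · exact Prod.ext (smul_algebraMap (F.fixingSubgroupEquiv ⟨σ, hσ⟩) x.1)
      (smul_map_algebraMap (F.fixingSubgroupEquiv ⟨σ, hσ⟩) x.2)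
  · exact Prod.ext (FaithfulSMul.algebraMap_injective _ _ (congrArg Prod.fst h))
      (map_algebraMap_injective_of_faithfullyFlat (congrArg Prod.snd h))

end TraceSet

section Frobenius

theorem sSup_algHom_ext {F E A : Type*} [Field F] [Field E] [Algebra F E] [Semiring A]
    [Algebra F A] {T : Set (IntermediateField F E)} {f g : (sSup T : IntermediateField F E) →ₐ[F] A}
    (h : ∀ (M) (hM : M ∈ T) (x : M), f ⟨x, le_sSup hM x.2⟩ = g ⟨x, le_sSup hM x.2⟩) : f = g :=
  IntermediateField.algHom_ext_of_eq_adjoin F (IntermediateField.sSup_def T)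
    fun x ⟨_, ⟨M, hM, rfl⟩, hx⟩ => h M hM ⟨x, hx⟩

section RestrictNormal

variable {L E M : Type*} [Field L] [Field E] [Field M] [Algebra L E] [Algebra L M] [Algebra E M]
  [IsScalarTower L E M] [Normal L E] {Q : Ideal (𝓞 M)}

theorem isArithFrobAt_restrictNormal {g : Gal(M/L)}
    (h : AlgHom.IsArithFrobAt (RingOfIntegers.mapAlgHom (k := L) g) Q) :
    AlgHom.IsArithFrobAt (RingOfIntegers.mapAlgHom (k := L) (g.restrictNormal E))
      (Q.under (𝓞 E)) := by
  intro x
  rw [Ideal.under_under, Ideal.mem_comap, map_sub, map_pow]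
  convert h (algebraMap (𝓞 E) (𝓞 M) x) using 2
  exact RingOfIntegers.ext (AlgEquiv.restrictNormal_commutes g E (x : E))

theorem restrictNormal_eq_of_isArithFrobAt [NumberField E] [Q.IsPrime]
    [Algebra.IsUnramifiedAt (𝓞 L) (Q.under (𝓞 E))] {g g' : Gal(M/L)}
    (hg : AlgHom.IsArithFrobAt (RingOfIntegers.mapAlgHom (k := L) g) Q)
    (hg' : AlgHom.IsArithFrobAt (RingOfIntegers.mapAlgHom (k := L) g') Q) :
    g.restrictNormal E = g'.restrictNormal E := by
  have hint := (isArithFrobAt_restrictNormal (E := E) hg).eq_of_isUnramifiedAt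
    (isArithFrobAt_restrictNormal hg') (Ideal.primeCompl_le_nonZeroDivisors _)
  have hhom : (g.restrictNormal E : E →+* E) = g'.restrictNormal E :=
    IsLocalization.ringHom_ext (nonZeroDivisors (𝓞 E)) <| RingHom.ext fun x =>
      congrArg RingOfIntegers.val (DFunLike.congr_fun hint x)
  exact AlgEquiv.ext fun x => DFunLike.congr_fun hhom x

end RestrictNormal

variable {K L : Type*} [Field K] [Field L] [Algebra K L] {S : Finset (HeightOneSpectrum (𝓞 K))}

theorem isFrobeniusAt_frobeniusAt {q : Ideal (𝓞 L)} (h : ∃ g, IsFrobeniusAt K L S q g) :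
    IsFrobeniusAt K L S q (frobeniusAt K L S q) := by
  rw [frobeniusAt, dif_pos h]
  exact h.choose_spec

theorem restrictNormal_eq_of_isFrobeniusAt [NumberField L] {q : Ideal (𝓞 L)} [q.IsPrime]
    (hq : q ≠ ⊥) (hqS : ∀ v ∈ S, ¬ q.LiesOver v.asIdeal) (E : Type*) [Field E] [NumberField E]
    [Algebra L E] [Algebra E (maxAbelian K L S)] [Algebra K E] [IsScalarTower K L E]
    [IsScalarTower L E (maxAbelian K L S)] [Normal L E] (hE : IsUnramifiedOutside K L E S)
    {g g' : HS K L S} (hg : IsFrobeniusAt K L S q g) (hg' : IsFrobeniusAt K L S q g') :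
    g.restrictNormal E = g'.restrictNormal E := by
  obtain ⟨Q, hQ, hQq⟩ := (inferInstance : Nonempty (q.primesOver (𝓞 (maxAbelian K L S))))
  have hPq : (Q.under (𝓞 E)).LiesOver q := ⟨by rw [hQq.over, Ideal.under_under]⟩
  have hPS (v) (hv : v ∈ S) : ¬ (Q.under (𝓞 E)).LiesOver v.asIdeal := fun hPv =>
    hqS v hv (Ideal.LiesOver.tower_bot (Q.under (𝓞 E)) q v.asIdeal)
  have := hE ⟨Q.under (𝓞 E), inferInstance, Ideal.ne_bot_of_liesOver_of_ne_bot hq _⟩ hPS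
  exact restrictNormal_eq_of_isArithFrobAt (hg Q hQ hQq) (hg' Q hQ hQq)

theorem IsFrobeniusAt.unique [NumberField L] {q : Ideal (𝓞 L)} [q.IsPrime] (hq : q ≠ ⊥)
    (hqS : ∀ v ∈ S, ¬ q.LiesOver v.asIdeal) {g g' : HS K L S} (hg : IsFrobeniusAt K L S q g)
    (hg' : IsFrobeniusAt K L S q g') : g = g' := by
  refine AlgEquiv.coe_toAlgHom_injective (sSup_algHom_ext fun E hE y => ?_)
  let i : E →ₐ[L] maxAbelian K L S := IntermediateField.inclusion (le_sSup hE)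
  obtain ⟨hfin, hab, hunr⟩ := hE
  have : NumberField E := NumberField.of_module_finite L E
  let : Algebra E (maxAbelian K L S) := i.toRingHom.toAlgebra
  have : IsScalarTower L E (maxAbelian K L S) := .of_algebraMap_eq fun x => (i.commutes x).symm
  have hres := restrictNormal_eq_of_isFrobeniusAt hq hqS E hunr hg hg'
  exact (AlgEquiv.restrictNormal_commutes g E y).symm.trans
    ((congrArg (fun f : Gal(E/L) => i (f y)) hres).trans (AlgEquiv.restrictNormal_commutes g' E y))

end Frobenius

section Conjugation

/-- Conjugation `h ↦ s h s⁻¹` by `s ∈ Gal(M/K)` as an endomorphism of `Gal(M/L)`. -/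
noncomputable def conjGalHom {K L M : Type*} [Field K] [Field L] [Field M] [Algebra K L]
    [Algebra K M] [Algebra L M] [IsScalarTower K L M] [Normal K L] (s : Gal(M/K)) :
    Gal(M/L) →* Gal(M/L) where
  toFun := conjGal s
  map_one' := AlgEquiv.ext s.apply_symm_apply
  map_mul' g h := AlgEquiv.ext fun x => (congrArg (fun y => s (g y))
    (s.symm_apply_apply (h (s⁻¹ x)))).symm

variable {K L : Type*} [Field K] [Field L] [Algebra K L] [Normal K L]
  {S : Finset (HeightOneSpectrum (𝓞 K))}

theorem IsFrobeniusAt.conjGal {q : Ideal (𝓞 L)} {g : HS K L S} (h : IsFrobeniusAt K L S q g)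
    (s : Gal(maxAbelian K L S/K)) :
    IsFrobeniusAt K L S (AlgEquiv.restrictNormalHom L s • q) (conjGal s g) := by
  intro Q hQ hQq x
  set σ := AlgEquiv.restrictNormalHom L s
  have hσ (y : 𝓞 L) : s • algebraMap (𝓞 L) (𝓞 (maxAbelian K L S)) y =
      algebraMap (𝓞 L) (𝓞 (maxAbelian K L S)) (σ • y) :=
    RingOfIntegers.ext (AlgEquiv.restrictNormal_commutes s L (y : L)).symm
  have hover : (s⁻¹ • Q).LiesOver q := ⟨by
    ext y
    rw [← Ideal.smul_mem_pointwise_smul_iff (a := σ), hQq.over, Ideal.mem_comap, Ideal.mem_comap,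
      ← hσ, Ideal.mem_inv_pointwise_smul_iff]⟩
  have hcard : Nat.card (𝓞 L ⧸ σ • q) = Nat.card (𝓞 L ⧸ q) := natCard_quotient_smul σ q
  have hx := h (s⁻¹ • Q) inferInstance hover (s⁻¹ • x)
  rw [← hover.over, Ideal.mem_inv_pointwise_smul_iff, smul_sub, smul_pow', smul_inv_smul] at hx
  rw [← hQq.over, hcard]
  exact hx

variable [NumberField L]

theorem frobeniusAt_smul {q : Ideal (𝓞 L)} [q.IsPrime] (hq : q ≠ ⊥)
    (hqS : ∀ v ∈ S, ¬ q.LiesOver v.asIdeal) (s : Gal(maxAbelian K L S/K)) :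
    frobeniusAt K L S (AlgEquiv.restrictNormalHom L s • q) =
      conjGal s (frobeniusAt K L S q) := by
  set σ := AlgEquiv.restrictNormalHom L s with hσ
  have hover (v) (hv : v ∈ S) : ¬ (σ • q).LiesOver v.asIdeal := fun h =>
    hqS v hv (inv_smul_smul σ q ▸ Ideal.LiesOver.smul σ⁻¹)
  have hbot : σ • q ≠ ⊥ := fun h => hq (by rw [← inv_smul_smul σ q, h, Ideal.smul_bot])
  by_cases h : ∃ g, IsFrobeniusAt K L S q g
  · have hconj := (isFrobeniusAt_frobeniusAt h).conjGal s
    exact (isFrobeniusAt_frobeniusAt ⟨_, hconj⟩).unique hbot hover hconj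
  · have hσq : ¬ ∃ g, IsFrobeniusAt K L S (σ • q) g := by
      rintro ⟨g, hg⟩
      have hinv := hg.conjGal s⁻¹
      rw [map_inv, ← hσ, inv_smul_smul] at hinv
      exact h ⟨_, hinv⟩
    rw [frobeniusAt, dif_neg hσq, frobeniusAt, dif_neg h]
    exact (map_one (conjGalHom s)).symm

open UniqueFactorizationMonoid in
theorem artinSymbol_smul {b : Ideal (𝓞 L)} (hb : IsPrimeTo S b)
    (s : Gal(maxAbelian K L S/K)) :
    artinSymbol K L S (AlgEquiv.restrictNormalHom L s • b) = conjGal s (artinSymbol K L S b) := by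
  rw [artinSymbol, normalizedFactors_smul, Multiset.map_map]
  refine .trans ?_ (Multiset.prod_hom _ (conjGalHom s))
  rw [Multiset.map_map]
  refine congrArg _ (Multiset.map_congr rfl fun q hq => ?_)
  have hprime := prime_of_normalized_factor q hq
  have := Ideal.isPrime_of_prime hprime
  exact frobeniusAt_smul hprime.ne_zero
    (hb.not_liesOver this.ne_top (Ideal.le_of_dvd (dvd_of_mem_normalizedFactors hq))) s

end Conjugation

section Congruence

theorem natCard_mul_relIndex {G : Type*} [Group G] {H T : Subgroup G} (h : H ≤ T) :
    Nat.card H * H.relIndex T = Nat.card T := by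
  rw [← Subgroup.relIndex_bot_left, ← Subgroup.relIndex_bot_left,
    Subgroup.relIndex_mul_relIndex _ _ _ bot_le h]

theorem eq_pow_relIndex_of_pow_natCard_eq {G : Type*} [Group G] [Finite G] {H T : Subgroup G}
    (h : H ≤ T) {m n : ℕ} (hmn : m ^ Nat.card H = n ^ Nat.card T) : m = n ^ H.relIndex T := by
  refine Nat.pow_left_injective Nat.card_pos.ne' (hmn.trans ?_ : _ ^ Nat.card H = _ ^ Nat.card H)
  rw [← pow_mul, mul_comm, natCard_mul_relIndex h]

variable {K L : Type*} [Field K] [Field L] [NumberField K] [NumberField L] [Algebra K L]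
  [IsGalois K L] {S : Finset (HeightOneSpectrum (𝓞 K))} {α : 𝓞 K}

theorem absNorm_pow_natCard_fixingSubgroup (F : IntermediateField K L) (a : Ideal (𝓞 F)) :
    Ideal.absNorm a ^ Nat.card F.fixingSubgroup =
      Ideal.absNorm (a.map (algebraMap (𝓞 F) (𝓞 L))) := by
  rw [Ideal.absNorm_algebraMap, IsGalois.card_fixingSubgroup_eq_finrank,
    IsFractionRing.finrank_eq (𝓞 F) F (𝓞 L) L]

variable (K) in
/-- The absolute norm of the contraction of `b` to the fixed field of the stabilizer of `(β, b)`.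
For `(β, b) ∈ [α]_L` the ideal `b` is extended from that field, so this is the root of order
`|Stab (β, b)|` of the norm of `b`. -/
noncomputable def stabilizerNorm (y : 𝓞 L × Ideal (𝓞 L)) : ℕ :=
  Ideal.absNorm (y.2.under
    (𝓞 (IntermediateField.fixedField (MulAction.stabilizer Gal(L/K) y))))

variable [IsTotallyReal L] (hSram : IsUnramifiedOutside K K L S) {y : 𝓞 L × Ideal (𝓞 L)}
  (hy : y ∈ traceSet S α L)
include hSram

include hy in
theorem stabilizerNorm_pow_natCard_stabilizer :
    stabilizerNorm K y ^ Nat.card (MulAction.stabilizer Gal(L/K) y) = Ideal.absNorm y.2 := by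
  set F := IntermediateField.fixedField (MulAction.stabilizer Gal(L/K) y)
  have hfix : F.fixingSubgroup = MulAction.stabilizer Gal(L/K) y :=
    IntermediateField.fixingSubgroup_fixedField _
  obtain ⟨x, -, hxy⟩ := (bijOn_traceSet hSram F).surjOn ⟨hy, fun σ hσ => hfix.le hσ⟩
  have hx : x.2.map (algebraMap (𝓞 F) (𝓞 L)) = y.2 := congrArg Prod.snd hxy
  change Ideal.absNorm (y.2.under (𝓞 F)) ^ _ = _
  rw [← hfix, ← hx, Ideal.under_def, Ideal.comap_map_eq_self_of_faithfullyFlat,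
    absNorm_pow_natCard_fixingSubgroup]

include hy in
theorem stabilizerNorm_smul (σ : Gal(L/K)) : stabilizerNorm K (σ • y) = stabilizerNorm K y := by
  have hcard : Nat.card (MulAction.stabilizer Gal(L/K) y) =
      Nat.card (MulAction.stabilizer Gal(L/K) (σ • y)) :=
    Nat.card_congr (MulAction.stabilizerEquivStabilizer rfl).toEquiv
  refine Nat.pow_left_injective (Nat.card_pos (α := MulAction.stabilizer Gal(L/K) y)).ne' ?_
  change _ ^ _ = _ ^ _
  rw [stabilizerNorm_pow_natCard_stabilizer hSram hy, hcard,
    stabilizerNorm_pow_natCard_stabilizer hSram ((traceSubMulAction S α L).smul_mem σ hy)]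
  exact natCard_quotient_smul σ y.2

theorem absNorm_pow_eq_stabilizerNorm_pow (F : IntermediateField K L)
    {x : 𝓞 F × Ideal (𝓞 F)} (hx : x ∈ traceSet S α F)
    (hxy : (algebraMap (𝓞 F) (𝓞 L) x.1, x.2.map (algebraMap (𝓞 F) (𝓞 L))) = y) (k : ℕ) :
    Ideal.absNorm x.2 ^ (Module.finrank F L * k - 1) =
      stabilizerNorm K y ^ (Nat.card (MulAction.stabilizer Gal(L/K) y) * k -
        F.fixingSubgroup.relIndex (MulAction.stabilizer Gal(L/K) y)) := by
  obtain ⟨hy, hfix⟩ := (bijOn_traceSet hSram F).mapsTo hx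
  simp only [hxy] at hy hfix
  have hle : F.fixingSubgroup ≤ MulAction.stabilizer Gal(L/K) y := hfix
  have hnorm : Ideal.absNorm x.2 =
      stabilizerNorm K y ^ F.fixingSubgroup.relIndex (MulAction.stabilizer Gal(L/K) y) := by
    refine eq_pow_relIndex_of_pow_natCard_eq hle ?_
    rw [stabilizerNorm_pow_natCard_stabilizer hSram hy, absNorm_pow_natCard_fixingSubgroup,
      ← hxy]
  rw [hnorm, ← pow_mul, Nat.mul_sub, mul_one, ← mul_assoc,
    ← IsGalois.card_fixingSubgroup_eq_finrank, mul_comm (Subgroup.relIndex _ _),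
    natCard_mul_relIndex hle]

theorem finsum_traceSet_eq_finsum_fixedPoints {R : Type*} [CommRing R] (F : IntermediateField K L)
    (ε : HS K L S → R) (k : ℕ) :
    ∑ᶠ x ∈ traceSet S α F, ε (artinSymbol K L S (x.2.map (algebraMap (𝓞 F) (𝓞 L)))) *
        (Ideal.absNorm x.2 : R) ^ (Module.finrank F L * k - 1) =
      ∑ᶠ y ∈ MulAction.fixedPoints F.fixingSubgroup (traceSubMulAction S α L),
        ε (artinSymbol K L S y.1.2) * (stabilizerNorm K y.1 : R) ^
          (Nat.card (MulAction.stabilizer Gal(L/K) y) * k -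
            F.fixingSubgroup.relIndex (MulAction.stabilizer Gal(L/K) y)) := by
  have hval : Set.BijOn Subtype.val
      (MulAction.fixedPoints F.fixingSubgroup (traceSubMulAction S α L))
      {y ∈ traceSet S α L | ∀ σ ∈ F.fixingSubgroup, σ • y = y} :=
    ⟨fun y hy => ⟨y.2, fun σ hσ => congrArg Subtype.val (hy ⟨σ, hσ⟩)⟩,
      Subtype.val_injective.injOn,
      fun y hy => ⟨⟨y, hy.1⟩, fun σ => Subtype.ext (hy.2 σ σ.2), rfl⟩⟩
  trans ∑ᶠ y ∈ {y ∈ traceSet S α L | ∀ σ ∈ F.fixingSubgroup, σ • y = y},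
    ε (artinSymbol K L S y.2) * (stabilizerNorm K y : R) ^
      (Nat.card (MulAction.stabilizer Gal(L/K) y) * k -
        F.fixingSubgroup.relIndex (MulAction.stabilizer Gal(L/K) y))
  · refine finsum_mem_eq_of_bijOn _ (bijOn_traceSet hSram F) fun x hx => ?_
    rw [← Nat.cast_pow, absNorm_pow_eq_stabilizerNorm_pow hSram F hx rfl, Nat.cast_pow]
  · symm
    refine finsum_mem_eq_of_bijOn _ hval fun y _ => ?_
    rw [SubMulAction.stabilizer_of_subMul]

theorem natCard_stabilizerFun_dvd_finsum {R : Type*} [CommRing R] {k : ℕ} (hk : 2 ≤ k)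
    (ε : HS K L S → R) :
    (Nat.card (stabilizerFun ε) : R) ∣
      ∑ᶠ F : IntermediateField K L, (subgroupMobius Gal(L/K) F.fixingSubgroup : R) *
        ∑ᶠ x ∈ traceSet S α F, ε (artinSymbol K L S (x.2.map (algebraMap (𝓞 F) (𝓞 L)))) *
          (Ideal.absNorm x.2 : R) ^ (Module.finrank F L * k - 1) := by
  have : Finite (traceSubMulAction S α L) := traceSet_finite S α
  have hε (a) (ha : a ∈ stabilizerFun ε) (y : traceSubMulAction S α L) :
      ε (artinSymbol K L S (a • y).1.2) = ε (artinSymbol K L S y.1.2) := by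
    obtain ⟨s, hs, rfl⟩ := ha
    exact (congrArg ε (artinSymbol_smul y.2.2.2.1 s)).trans (hs _)
  have hn (σ : Gal(L/K)) (y : traceSubMulAction S α L) :
      stabilizerNorm K (σ • y).1 = stabilizerNorm K y.1 := stabilizerNorm_smul hSram y.2 σ
  convert natCard_dvd_finsum_mobius_mul_finsum_fixedPoints_mul_pow (X := traceSubMulAction S α L)
    (stabilizerFun ε) (ε := fun y => ε (artinSymbol K L S y.1.2)) hε
    (n := fun y => stabilizerNorm K y.1) hn hk using 1
  refine finsum_eq_of_bijective _ (IsGalois.intermediateFieldEquivSubgroup (F := K)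
    (E := L)).bijective fun F => ?_
  rw [finsum_traceSet_eq_finsum_fixedPoints hSram]
  rfl

end Congruence

theorem proposition9_general {K L : Type*} [Field K] [Field L] [NumberField K] [NumberField L]
    [Algebra K L] [IsGalois K L] [IsTotallyReal L] (S : Finset (HeightOneSpectrum (𝓞 K)))
    (hSram : IsUnramifiedOutside K K L S) (α : 𝓞 K) :
    (∀ F : IntermediateField K L,
      (traceSet S α F).Finite ∧
      Set.BijOn
        (fun x : 𝓞 F × Ideal (𝓞 F) =>
          (algebraMap (𝓞 F) (𝓞 L) x.1, x.2.map (algebraMap (𝓞 F) (𝓞 L))))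
        (traceSet S α F)
        {y ∈ traceSet S α L | ∀ σ ∈ F.fixingSubgroup, σ • y = y}) ∧
    (∀ (R : Type*) [CommRing R] (k : ℕ), 2 ≤ k → ∀ ε : HS K L S → R,
      (Nat.card (stabilizerFun ε) : R) ∣
        ∑ᶠ F : IntermediateField K L, (subgroupMobius Gal(L/K) F.fixingSubgroup : R) *
          ∑ᶠ x ∈ traceSet S α F,
            ε (artinSymbol K L S (x.2.map (algebraMap (𝓞 F) (𝓞 L)))) *
              (Ideal.absNorm x.2 : R) ^ (Module.finrank F L * k - 1)) ∧
    (∀ (A : Type*) [CommRing A] [Algebra ℤ A] (M : Submonoid ℤ) [IsLocalization M A]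
      (P : Type*) [Group P] [Finite P] (r : A),
      (Nat.card P : A) ∣ ∑ᶠ P' : Subgroup P, (subgroupMobius P P' : A) * r ^ P'.index) := by
  refine ⟨fun F => ?_, fun R _ k hk ε => natCard_stabilizerFun_dvd_finsum hSram hk ε,
    fun A _ _ M _ P _ _ r => natCard_dvd_mobiusSum_pow M r⟩
  have := IsTotallyReal.of_algebra F L
  exact ⟨traceSet_finite S α, bijOn_traceSet hSram F⟩

theorem proposition9 {K L : Type*} [Field K] [Field L] [NumberField K] [NumberField L]
    [Algebra K L] [IsGalois K L] [IsTotallyReal K] [IsTotallyReal L]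
    (p : ℕ) [Fact p.Prime] (hdeg : ∃ n : ℕ, Module.finrank K L = p ^ n)
    (S : Finset (HeightOneSpectrum (𝓞 K)))
    (hSp : ∀ v : HeightOneSpectrum (𝓞 K), (p : 𝓞 K) ∈ v.asIdeal → v ∈ S)
    (hSram : IsUnramifiedOutside K K L S)
    (α : 𝓞 K) (hα : IsTotallyPositive α) :
    -- The set `[α]_F` is finite and is identified with the fixed points in `[α]_L` of `Gal(L/F)`.
    (∀ F : IntermediateField K L,
      (traceSet S α F).Finite ∧
      Set.BijOn
        (fun x : 𝓞 F × Ideal (𝓞 F) =>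
          (algebraMap (𝓞 F) (𝓞 L) x.1, x.2.map (algebraMap (𝓞 F) (𝓞 L))))
        (traceSet S α F)
        {y ∈ traceSet S α L | ∀ σ ∈ F.fixingSubgroup, σ • y = y}) ∧
    -- The congruence for the Möbius sum.
    (∀ (k : ℕ), 0 < k → Even k →
      ∀ ε : HS K L S → ZLoc p, IsLocallyConstant ε → IsEvenFunction ε →
      (Nat.card (stabilizerFun ε) : ZLoc p) ∣
        ∑ᶠ F : IntermediateField K L, (subgroupMobius Gal(L/K) F.fixingSubgroup : ZLoc p) *
          ∑ᶠ x ∈ traceSet S α F,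
            ε (artinSymbol K L S (x.2.map (algebraMap (𝓞 F) (𝓞 L)))) *
              (Ideal.absNorm x.2 : ZLoc p) ^ (Module.finrank F L * k - 1)) ∧
    -- The congruence for finite `p`-groups.
    (∀ (P : Type*) [Group P] [Finite P], IsPGroup p P → ∀ r : (ZLoc p)ˣ,
      (Nat.card P : ZLoc p) ∣
        ∑ᶠ P' : Subgroup P, (subgroupMobius P P' : ZLoc p) * (r : ZLoc p) ^ P'.index) := by
  obtain ⟨hfix, hsum, hpow⟩ := proposition9_general S hSram α
  refine ⟨hfix, fun k hk heven ε _ _ => hsum _ k ?_ ε, fun P _ _ _ r =>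
    hpow _ (Ideal.span {(p : ℤ)}).primeCompl P (r : ZLoc p)⟩
  obtain ⟨m, rfl⟩ := heven
  omega
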